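/- Let $p$ be an odd prime and let $m,n\in\mathbb N$ be such that $2^m\mid p^n-1$ and $2^{m+1}\nmid p^n-1$; put $d=(p^n-1)/2^m$. Let $K=\mathbb F_p(t_1,\dots,t_n)$ with independent indeterminates $t_i$. Fix any basis $e_1,\dots,e_n$ of $\mathbb F_{p^n}$ over $\mathbb F_p$; for $z=a_1e_1+\dots+a_ne_n$, the matrix of the $\mathbb F_p$-linear map $y\mapsto zy$ in this basis is $(f_{ij}(a_1,\dots,a_n))_{i,j}$ with linear forms $f_{ij}\in\mathbb F_p[x_1,\dots,x_n]$, and the torus $T=\mathrm{Res}_{\mathbb F_{p^n}/\mathbb F_p}\mathbf G_m\subset\mathbf{GL}_n$ is given by $T(R)=\{(f_{ij}(a)) : a\in R^n,\ \det (f_{ij}(a))\in R^\times\}$ for commutative $\mathbb F_p$-algebras $R$. Let $A=(f_{ij}(t_1,\dots,t_n))$ be the general matrix of $T$. For a field $L\supseteq\mathbb F_p$ and $B\in \mathbf{GL}_n(L)$, the Frobenius module $(L^n,\Phi_B)$ is $L^n$ with the map $\Phi_B(X)=BX^{(p)}$, where $X^{(p)}$ is the entrywise $p$-th power (so $\Phi_B$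 is $\mathbb F_p$-linear, $\Phi_B(aX)=a^p\Phi_B(X)$, and its natural extension to $\overline L\otimes_L L^n$ is injective); its splitting field is the subfield $E\subseteq\overline L$ generated over $L$ by the coordinates of all solutions $X\in\overline L^{\,n}$ of $BX^{(p)}=X$, and its Galois group is $\mathrm{Gal}(E/L)$. Then $A\in T(K)$ and the Frobenius module $(K^n,\Phi_{A^d})$ is $C_{2^m}$-generic over $\mathbb F_p$, where $C_{2^m}$ is the cyclic group of order $2^m$; that is: 1. the splitting field of $(K^n,\Phi_{A^d})$ is Galois over $K$, with Galois group isomorphic to $C_{2^m}$; 2. for every field $L\supseteq\mathbb F_p$ and every Galois extension $M/L$ with group isomorphic to $C_{2^m}$, there is $\xi\in L^n$ such that the specialization $A^d(\xi)$ is defined and lies in $\mathbf{GL}_n(L)$, and $M$ is ($L$-isomorphic to) the splitting field of $(L^n,\Phi_{A^d(\xi)})$. -/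

import Mathlib

open scoped TensorProduct

universe u v

/-- `Φ` makes the `K`-vector space `M` a Frobenius module over `K ⊇ F = 𝔽_q` (`q = Nat.card F`):
`M` is finite dimensional, `Φ` is `𝔽_q`-linear, `Φ (a x) = a ^ q Φ x`, and the natural extension
`c ⊗ x ↦ c ^ q ⊗ Φ x` of `Φ` to `K̄ ⊗ M` (which is the only additive map with these values) is
injective. -/
structure IsFrobeniusModule (F K M : Type*) [Field F] [Field K] [Algebra F K]
    [AddCommGroup M] [Module F M] [Module K M] (Φ : M → M) : Prop where
  finite : Module.Finite K M
  isLinearMap : IsLinearMap F Φ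
  map_smul : ∀ (a : K) (x : M), Φ (a • x) = a ^ Nat.card F • Φ x
  injective_extension :
    ∃ Ψ : (AlgebraicClosure K ⊗[K] M) →+ (AlgebraicClosure K ⊗[K] M),
      (∀ (c : AlgebraicClosure K) (x : M), Ψ (c ⊗ₜ[K] x) = (c ^ Nat.card F) ⊗ₜ[K] Φ x) ∧
      Function.Injective Ψ

/-- The map `Φ_A : X ↦ A X^(q)` on column vectors, `X^(q)` being the entrywise `q`-th power. -/
def frobeniusMap {ι K : Type*} [Fintype ι] [Field K] (q : ℕ) (A : Matrix ι ι K) :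
    (ι → K) → (ι → K) :=
  fun X => A.mulVec (fun i => X i ^ q)

/-- The solution space `{X ∈ K̄ⁿ : A X^(q) = X}` of `(Kⁿ, Φ_A)`. -/
def frobeniusSolutions {ι K : Type*} [Fintype ι] [Field K] (q : ℕ) (A : Matrix ι ι K) :
    Set (ι → AlgebraicClosure K) :=
  {X | frobeniusMap q (A.map (algebraMap K (AlgebraicClosure K))) X = X}

/-- The splitting field of `(Kⁿ, Φ_A)`: the subfield of `K̄` generated over `K` by the coordinates
of all solutions of `A X^(q) = X`. -/
noncomputable def frobeniusSplittingField {ι K : Type*} [Fintype ι] [Field K] (q : ℕ)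
    (A : Matrix ι ι K) : IntermediateField K (AlgebraicClosure K) :=
  IntermediateField.adjoin K {y | ∃ X ∈ frobeniusSolutions q A, ∃ i, X i = y}

/-- `B` is the specialization `A(ξ)` of the matrix `A` of rational functions over `F` at a point
`ξ` with coordinates in `L ⊇ F`: every entry of `A` can be written as `f / g` with `g(ξ) ≠ 0`, and
the corresponding entry of `B` is `f(ξ) / g(ξ)`. -/
def IsSpecialization {ι σ F L : Type*} [Field F] [Field L] [Algebra F L]
    (A : Matrix ι ι (FractionRing (MvPolynomial σ F))) (ξ : σ → L) (B : Matrix ι ι L) : Prop :=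
  ∀ i j, ∃ f g : MvPolynomial σ F, MvPolynomial.aeval ξ g ≠ 0 ∧
    A i j = algebraMap _ (FractionRing (MvPolynomial σ F)) f /
      algebraMap _ (FractionRing (MvPolynomial σ F)) g ∧
    B i j = MvPolynomial.aeval ξ f / MvPolynomial.aeval ξ g

/-- `(Kⁿ, Φ_A)`, where `K = F(t)` and `F = 𝔽_q`, is a `G`-generic Frobenius module over `F`. -/
structure IsGenericFrobeniusModule (F G : Type*) [Field F] [Group G] {ι σ : Type*} [Fintype ι]
    (A : Matrix ι ι (FractionRing (MvPolynomial σ F))) : Prop where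
  isFrobeniusModule :
    IsFrobeniusModule F (FractionRing (MvPolynomial σ F)) (ι → FractionRing (MvPolynomial σ F))
      (frobeniusMap (Nat.card F) A)
  /-- the splitting field `E / K` is Galois and its Galois group is isomorphic to `G` -/
  isGalois : IsGalois (FractionRing (MvPolynomial σ F)) (frobeniusSplittingField (Nat.card F) A)
  galoisGroup :
    Nonempty ((frobeniusSplittingField (Nat.card F) A ≃ₐ[FractionRing (MvPolynomial σ F)]
      frobeniusSplittingField (Nat.card F) A) ≃* G)
  /-- every Galois extension `M / L` with group `G` and `L ⊇ F` is the splitting field of the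
  Frobenius module `(Lⁿ, Φ_B)` of some specialization `B = A(ξ)` -/
  specialization :
    ∀ (L : Type u) (M : Type v) [Field L] [Field M] [Algebra F L] [Algebra L M]
      [FiniteDimensional L M] [IsGalois L M], Nonempty ((M ≃ₐ[L] M) ≃* G) →
      ∃ (ξ : σ → L) (B : Matrix ι ι L), IsSpecialization A ξ B ∧
        IsFrobeniusModule F L (ι → L) (frobeniusMap (Nat.card F) B) ∧
        Nonempty (M ≃ₐ[L] frobeniusSplittingField (Nat.card F) B)

/-- The matrix `(f_ij(a))` of multiplication by `∑ l, a l • b l` on `R ⊗ E` in the basis `b` of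
`E / k`, for `a` with coordinates in a commutative `k`-algebra `R`. -/
noncomputable def mulMatrix {k E ι : Type*} [Field k] [Field E] [Algebra k E] [Fintype ι]
    [DecidableEq ι] (b : Module.Basis ι k E) {R : Type*} [CommRing R] [Algebra k R] (a : ι → R) :
    Matrix ι ι R :=
  ∑ l, a l • (Algebra.leftMulMatrix b (b l)).map (algebraMap k R)

/-- The `R`-points of the torus `Res_{E/k} 𝔾_m ⊆ GL_n`, embedded by means of the basis `b`. -/
def weilRestrictionGm {k E ι : Type*} [Field k] [Field E] [Algebra k E] [Fintype ι]
    [DecidableEq ι] (b : Module.Basis ι k E) (R : Type*) [CommRing R] [Algebra k R] :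
    Set (Matrix ι ι R) :=
  {M | (∃ a : ι → R, M = mulMatrix b a) ∧ IsUnit M.det}

/-- The general matrix of `Res_{E/k} 𝔾_m`: the matrix `(f_ij(t))` over `k(t)`, where the
`t_i` are independent indeterminates. -/
noncomputable def generalMatrix {k E ι : Type*} [Field k] [Field E] [Algebra k E] [Fintype ι]
    [DecidableEq ι] (b : Module.Basis ι k E) : Matrix ι ι (FractionRing (MvPolynomial ι k)) :=
  mulMatrix b (fun i => algebraMap (MvPolynomial ι k) (FractionRing (MvPolynomial ι k))
    (MvPolynomial.X i))

/-!
Write `E` for the field with `p ^ n` elements and `R ⊗ E` for its scalar extension to an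
`𝔽_p`-algebra `R`. The torus `T` is the group of units of `R ⊗ E`, acting on `R ⊗ E ≃ Rⁿ` by
multiplication (`baseMulMatrix`), and the entrywise Frobenius corresponds to `φ = Frob ⊗ id`
(`frobTensor`). If `w` is a unit of `L̄ ⊗ E` with `a ^ d * φ w = w`, then all solutions of
`A ^ d X^(p) = X`, where `A` is the matrix of `a`, are `𝔽_p`-combinations of the columns of the
matrix of `w`. Hence the splitting field is generated by the entries of that matrix
(`frobeniusSplittingField_baseMulMatrix`), and an automorphism `γ` acts by `γ w = χ(γ) w` for a
character `χ` of the Galois group with values in `T(𝔽_p) = Eˣ`, a cyclic group of order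
`d * 2 ^ m`.

*Every cyclic extension is obtained.* Given `M / L` with group `C_{2 ^ m}`, let `χ` be an injective
character to `Eˣ`; as `d` is odd, `χ ^ d` is injective too. Hilbert 90, in the form of a resolvent
of a normal basis generator, gives a unit `v` of `M ⊗ E` with `γ v = χ(γ) v`
(`exists_isUnit_galTensor_eq`). Then `a = v / φ v` is Galois invariant, so it comes from `L ⊗ E`,
and `w = v ^ d` solves `a ^ d * φ w = w` with character `χ ^ d`, so its coordinates generate `M`
(`exists_splittingField_mulMatrix_pow`).

*The generic extension is cyclic of order `2 ^ m`.* Lang's theorem for `T` over the separable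
closure gives a unit `u` with `a * φ u = u` for the general element `a`
(`exists_isUnit_mul_frobTensor_eq`). Since `φ ^ n` is the `p ^ n`-th power map of the ring `R ⊗ E`,
iterating gives `u ^ (p ^ n - 1) = N⁻¹` with `N = ∏ j < n, φ ^ j a`, so `w = u ^ d` satisfies
`w ^ 2 ^ m = N⁻¹`. The Galois group therefore embeds in the group of `2 ^ m`-th roots of unity of
`E`. Were the embedding not onto, `w ^ 2 ^ (m - 1)` would be a square root of `N⁻¹` over the base
field (`nonempty_galoisGroup_mulEquiv`). This is impossible, because under `𝔽_p(t) ⊗ E → E(t)` the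
element `N` becomes a polynomial which the linear form `∑ b_i t_i` divides exactly once
(`sq_mul_frobNorm_generalElement_ne_one`).
-/

/-! ### Extension of scalars and multiplication matrices -/

section ScalarExtension

variable {k E ι : Type*} [Field k] [Field E] [Algebra k E]
variable {R S T : Type*} [CommRing R] [Algebra k R] [CommRing S] [Algebra k S]
  [CommRing T] [Algebra k T]

variable (E) in
/-- The homomorphism `f ⊗ id : R ⊗ E → S ⊗ E` induced by `f : R → S`. -/
noncomputable def extendHom (f : R →ₐ[k] S) : R ⊗[k] E →ₐ[k] S ⊗[k] E :=
  Algebra.TensorProduct.map f (AlgHom.id k E)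

@[simp]
theorem extendHom_tmul (f : R →ₐ[k] S) (r : R) (e : E) :
    extendHom E f (r ⊗ₜ e) = f r ⊗ₜ e := by
  simp [extendHom]

theorem extendHom_comp_apply (g : S →ₐ[k] T) (f : R →ₐ[k] S) (x : R ⊗[k] E) :
    extendHom E g (extendHom E f x) = extendHom E (g.comp f) x := by
  induction x with
  | zero => simp
  | tmul r e => simp
  | add x y hx hy => simp only [map_add, hx, hy]

variable (b : Module.Basis ι k E)

theorem repr_extendHom (f : R →ₐ[k] S) (x : R ⊗[k] E) (i : ι) :
    (Algebra.TensorProduct.basis S b).repr (extendHom E f x) i =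
      f ((Algebra.TensorProduct.basis R b).repr x i) := by
  induction x with
  | zero => simp
  | tmul r e => simp
  | add x y hx hy => simp only [map_add, Finsupp.add_apply, hx, hy]

theorem extendHom_injective (b : Module.Basis ι k E) {f : R →ₐ[k] S}
    (hf : Function.Injective f) : Function.Injective (extendHom E f) := by
  intro x y h
  apply (Algebra.TensorProduct.basis R b).repr.injective
  ext i
  apply hf
  rw [← repr_extendHom, ← repr_extendHom, h]

variable [Fintype ι]

theorem sum_repr_tmul (x : R ⊗[k] E) :
    ∑ i, (Algebra.TensorProduct.basis R b).repr x i ⊗ₜ[k] b i = x := by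
  conv_rhs => rw [← (Algebra.TensorProduct.basis R b).sum_repr x]
  simp [TensorProduct.smul_tmul']

/-- An element of `S ⊗ E` descends to `R ⊗ E` as soon as its coordinates descend to `R`. -/
theorem exists_extendHom_eq (f : R →ₐ[k] S) (x : S ⊗[k] E)
    (h : ∀ i, ∃ r, f r = (Algebra.TensorProduct.basis S b).repr x i) :
    ∃ y, extendHom E f y = x := by
  choose r hr using h
  refine ⟨∑ i, r i ⊗ₜ b i, ?_⟩
  rw [map_sum]
  simp only [extendHom_tmul, hr]
  exact sum_repr_tmul b x

variable [DecidableEq ι]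

variable (R) in
/-- The matrix of multiplication by an element of `R ⊗ E`, in the basis of `R ⊗ E` over `R`
induced by a basis of `E`. -/
noncomputable def baseMulMatrix : R ⊗[k] E →ₐ[R] Matrix ι ι R :=
  Algebra.leftMulMatrix (Algebra.TensorProduct.basis R b)

theorem baseMulMatrix_tmul (r : R) (e : E) :
    baseMulMatrix R b (r ⊗ₜ e) = r • (Algebra.leftMulMatrix b e).map (algebraMap k R) := by
  have h : (r ⊗ₜ[k] e : R ⊗[k] E) = r • ((1 : R) ⊗ₜ[k] e) := by
    simp [TensorProduct.smul_tmul']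
  rw [h, map_smul]
  congr 1
  ext i j
  simp [baseMulMatrix, Algebra.leftMulMatrix_eq_repr_mul]

theorem mulMatrix_eq_baseMulMatrix (a : ι → R) :
    mulMatrix b a = baseMulMatrix R b (∑ i, a i ⊗ₜ b i) := by
  simp only [mulMatrix, map_sum, baseMulMatrix_tmul]

theorem baseMulMatrix_eq_mulMatrix (x : R ⊗[k] E) :
    baseMulMatrix R b x = mulMatrix b fun i => (Algebra.TensorProduct.basis R b).repr x i := by
  rw [mulMatrix_eq_baseMulMatrix, sum_repr_tmul]

theorem baseMulMatrix_injective : Function.Injective (baseMulMatrix R b) :=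
  Algebra.leftMulMatrix_injective _

theorem baseMulMatrix_extendHom (f : R →ₐ[k] S) (x : R ⊗[k] E) :
    baseMulMatrix S b (extendHom E f x) = (baseMulMatrix R b x).map f := by
  induction x with
  | zero => ext; simp
  | tmul r e => ext; simp [baseMulMatrix_tmul]
  | add x y hx hy => ext; simp [hx, hy]

theorem baseMulMatrix_mulVec_repr (x y : R ⊗[k] E) :
    Matrix.mulVec (baseMulMatrix R b x) ((Algebra.TensorProduct.basis R b).repr y) =
      (Algebra.TensorProduct.basis R b).repr (x * y) :=
  Algebra.leftMulMatrix_mulVec_repr _ _ _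

/-- The coordinates of `x` are recovered linearly from the matrix of multiplication by `x`, by
applying it to the coordinates of `1`. -/
theorem repr_eq_sum_baseMulMatrix (x : R ⊗[k] E) (i : ι) :
    (Algebra.TensorProduct.basis R b).repr x i =
      ∑ j, baseMulMatrix R b x i j * algebraMap k R (b.repr 1 j) := by
  have h := congrFun (baseMulMatrix_mulVec_repr b x 1) i
  rw [mul_one] at h
  rw [← h, Algebra.TensorProduct.one_def]
  simp [Matrix.mulVec, dotProduct]

theorem isUnit_of_isUnit_det_baseMulMatrix (x : R ⊗[k] E)
    (h : IsUnit (baseMulMatrix R b x).det) : IsUnit x := by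
  have h1 : IsUnit (baseMulMatrix R b x) := (Matrix.isUnit_iff_isUnit_det _).2 h
  obtain ⟨y, hy⟩ : ∃ y, x * y = 1 := by
    obtain ⟨B, hB⟩ := h1.exists_right_inv
    have := (Algebra.TensorProduct.basis R b).equivFun.surjective
      (Matrix.mulVec B ((Algebra.TensorProduct.basis R b).repr 1))
    obtain ⟨y, hy⟩ := this
    refine ⟨y, (Algebra.TensorProduct.basis R b).repr.injective ?_⟩
    apply DFunLike.coe_injective
    rw [← baseMulMatrix_mulVec_repr]
    rw [Module.Basis.equivFun_apply] at hy
    rw [hy, Matrix.mulVec_mulVec, hB, Matrix.one_mulVec]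
  exact IsUnit.of_mul_eq_one y hy

theorem isUnit_det_baseMulMatrix {x : R ⊗[k] E} (h : IsUnit x) :
    IsUnit (baseMulMatrix R b x).det :=
  (Matrix.isUnit_iff_isUnit_det _).1 (h.map (baseMulMatrix R b))

theorem isUnit_of_isUnit_extendHom {K L : Type*} [Field K] [Algebra k K] [Field L] [Algebra k L]
    (b : Module.Basis ι k E) (f : K →ₐ[k] L) {x : K ⊗[k] E} (h : IsUnit (extendHom E f x)) :
    IsUnit x := by
  refine isUnit_of_isUnit_det_baseMulMatrix b x (isUnit_iff_ne_zero.2 fun h0 => ?_)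
  apply (isUnit_det_baseMulMatrix b h).ne_zero
  rw [baseMulMatrix_extendHom, ← map_zero f, ← h0]
  exact (RingHom.map_det (f : K →+* L) _).symm

end ScalarExtension

/-! ### The Frobenius of the first factor -/

section Frobenius

variable (p : ℕ) [Fact p.Prime] (E : Type*) [Field E] [Algebra (ZMod p) E]
variable (R : Type*) [CommRing R] [Algebra (ZMod p) R]

/-- The endomorphism `Frob ⊗ id` of `R ⊗ E`. -/
noncomputable def frobTensor : R ⊗[ZMod p] E →ₐ[ZMod p] R ⊗[ZMod p] E :=
  extendHom E (FiniteField.frobeniusAlgHom (ZMod p) R)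

variable {R E}

@[simp]
theorem frobTensor_tmul (r : R) (e : E) : frobTensor p E R (r ⊗ₜ e) = (r ^ p) ⊗ₜ e := by
  simp [frobTensor]

theorem frobTensor_extendHom {S : Type*} [CommRing S] [Algebra (ZMod p) S] (f : R →ₐ[ZMod p] S)
    (x : R ⊗[ZMod p] E) :
    frobTensor p E S (extendHom E f x) = extendHom E f (frobTensor p E R x) := by
  induction x with
  | zero => simp
  | tmul r e => simp
  | add x y hx hy => simp only [map_add, hx, hy]

theorem baseMulMatrix_frobTensor {ι : Type*} [Fintype ι] [DecidableEq ι]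
    (b : Module.Basis ι (ZMod p) E) (x : R ⊗[ZMod p] E) :
    baseMulMatrix R b (frobTensor p E R x) = (baseMulMatrix R b x).map (· ^ p) := by
  rw [frobTensor, baseMulMatrix_extendHom]
  ext i j
  simp

theorem exists_algebraMap_eq_of_pow_eq {K : Type*} [Field K] [Algebra (ZMod p) K] {x : K}
    (h : x ^ p = x) : ∃ c : ZMod p, algebraMap (ZMod p) K c = x := by
  have : CharP K p := charP_of_injective_algebraMap (algebraMap (ZMod p) K).injective p
  have := (Subfield.mem_bot_iff_pow_eq_self (F := K) (p := p)).2 h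
  rw [← ZMod.fieldRange_castHom_eq_bot p] at this
  obtain ⟨c, hc⟩ := this
  exact ⟨c, by rw [← hc]; exact congrArg (· c) (Subsingleton.elim (algebraMap (ZMod p) K) _)⟩

/-- The fixed points of `Frob ⊗ id` are the elements of `E`. -/
theorem exists_one_tmul_eq_of_frobTensor_eq [FiniteDimensional (ZMod p) E]
    {K : Type*} [Field K] [Algebra (ZMod p) K]
    {x : K ⊗[ZMod p] E} (h : frobTensor p E K x = x) : ∃ e : E, 1 ⊗ₜ e = x := by
  let b := Module.finBasis (ZMod p) E
  have h1 : ∀ i, ∃ c : ZMod p, algebraMap (ZMod p) K c =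
      (Algebra.TensorProduct.basis K b).repr x i := by
    intro i
    apply exists_algebraMap_eq_of_pow_eq
    conv_rhs => rw [← h, frobTensor, repr_extendHom]
    simp
  choose c hc using h1
  refine ⟨∑ i, c i • b i, ?_⟩
  rw [TensorProduct.tmul_sum, ← sum_repr_tmul b x]
  refine Finset.sum_congr rfl fun i _ => ?_
  rw [← hc, TensorProduct.tmul_smul, TensorProduct.smul_tmul', Algebra.algebraMap_eq_smul_one]

theorem one_tmul_injective {K : Type*} [Field K] [Algebra (ZMod p) K] :
    Function.Injective (fun e : E => (1 : K) ⊗ₜ[ZMod p] e) :=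
  Algebra.TensorProduct.includeRight_injective (algebraMap (ZMod p) K).injective

theorem iterate_frobTensor_eq_pow (n : ℕ) (hE : ∀ e : E, e ^ p ^ n = e) (x : R ⊗[ZMod p] E) :
    (frobTensor p E R)^[n] x = x ^ p ^ n := by
  have key : ∀ (j : ℕ) (r : R) (e : E), (frobTensor p E R)^[j] (r ⊗ₜ e) = (r ^ p ^ j) ⊗ₜ e := by
    intro j r e
    induction j with
    | zero => simp
    | succ j ih => rw [Function.iterate_succ_apply', ih, frobTensor_tmul, ← pow_mul, pow_succ]
  nontriviality R ⊗[ZMod p] E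
  have : CharP (R ⊗[ZMod p] E) p :=
    charP_of_injective_algebraMap (algebraMap (ZMod p) (R ⊗[ZMod p] E)).injective p
  induction x with
  | zero => rw [iterate_map_zero, zero_pow (pow_ne_zero _ (Fact.out : p.Prime).ne_zero)]
  | tmul r e => rw [key, Algebra.TensorProduct.tmul_pow, hE]
  | add x y hx hy => rw [iterate_map_add, hx, hy, add_pow_char_pow]

end Frobenius

/-! ### Frobenius modules and their splitting fields -/

section FrobeniusModule

variable {p : ℕ} [Fact p.Prime] {ι : Type*} [Fintype ι]
variable {L : Type*} [Field L] [Algebra (ZMod p) L]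

theorem frobeniusMap_add (B : Matrix ι ι L) (x y : ι → L) :
    frobeniusMap p B (x + y) = frobeniusMap p B x + frobeniusMap p B y := by
  have : CharP L p := charP_of_injective_algebraMap (algebraMap (ZMod p) L).injective p
  rw [frobeniusMap, frobeniusMap, frobeniusMap, ← Matrix.mulVec_add]
  congr 1
  ext i
  exact add_pow_char (x i) (y i) p

theorem frobeniusMap_smul {q : ℕ} {ι L : Type*} [Fintype ι] [Field L] (B : Matrix ι ι L) (c : L)
    (x : ι → L) :
    frobeniusMap q B (c • x) = c ^ q • frobeniusMap q B x := by
  rw [frobeniusMap, frobeniusMap, ← Matrix.mulVec_smul]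
  congr 1
  ext i
  simp [mul_pow]

theorem frobeniusMap_mulVec (B U : Matrix ι ι L) (x : ι → L) :
    frobeniusMap p B (U.mulVec x) = (B * U.map (· ^ p)).mulVec fun i => x i ^ p := by
  have : CharP L p := charP_of_injective_algebraMap (algebraMap (ZMod p) L).injective p
  rw [frobeniusMap, ← Matrix.mulVec_mulVec]
  congr 1
  ext i
  simp only [Matrix.mulVec, dotProduct, Matrix.map_apply, ← mul_pow]
  exact sum_pow_char p _ _

variable [DecidableEq ι]

theorem frobeniusMap_injective {B : Matrix ι ι L} (hB : IsUnit B.det) :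
    Function.Injective (frobeniusMap p B) := by
  have : CharP L p := charP_of_injective_algebraMap (algebraMap (ZMod p) L).injective p
  intro x y h
  have h1 := Matrix.mulVec_injective_of_isUnit ((Matrix.isUnit_iff_isUnit_det B).2 hB) h
  ext i
  exact frobenius_inj L p (congrFun h1 i)

/-- An invertible matrix defines a Frobenius module: over the algebraic closure, `Φ_B` is the
composite of the injective coordinatewise Frobenius and an invertible linear map. -/
theorem isFrobeniusModule_of_isUnit_det (B : Matrix ι ι L) (hB : IsUnit B.det) :
    IsFrobeniusModule (ZMod p) L (ι → L) (frobeniusMap (Nat.card (ZMod p)) B) := by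
  rw [Nat.card_zmod]
  refine ⟨inferInstance, ⟨frobeniusMap_add B, fun c x => ?_⟩, ?_, ?_⟩
  · rw [← algebraMap_smul L c x, frobeniusMap_smul, ← map_pow, ZMod.pow_card, algebraMap_smul]
  · rw [Nat.card_zmod]
    exact frobeniusMap_smul B
  · rw [Nat.card_zmod]
    let Ω := AlgebraicClosure L
    let e := TensorProduct.piScalarRight L L Ω ι
    let B' : Matrix ι ι Ω := B.map (algebraMap L Ω)
    have hB' : IsUnit B'.det := by
      have := hB.map (algebraMap L Ω)
      rwa [RingHom.map_det] at this
    let f : (ι → Ω) →+ (ι → Ω) := AddMonoidHom.mk' (frobeniusMap p B') (frobeniusMap_add B')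
    refine ⟨e.symm.toAddEquiv.toAddMonoidHom.comp (f.comp e.toAddEquiv.toAddMonoidHom),
      fun c x => ?_, ?_⟩
    · apply e.injective
      change e (e.symm (frobeniusMap p B' (e (c ⊗ₜ x)))) = _
      rw [LinearEquiv.apply_symm_apply]
      simp only [e, TensorProduct.piScalarRight_apply, TensorProduct.piScalarRightHom_tmul]
      ext i
      simp only [frobeniusMap, Matrix.mulVec, dotProduct, Algebra.smul_def, mul_pow, map_sum,
        map_mul, map_pow, Finset.sum_mul, B', Matrix.map_apply]
      exact Finset.sum_congr rfl fun j _ => by ring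
    · exact e.symm.injective.comp ((frobeniusMap_injective hB').comp e.injective)

/-- If `B U^(p) = U` for an invertible matrix `U` over the algebraic closure, then the solutions
of `B X^(p) = X` are the `𝔽_p`-linear combinations of the columns of `U`, so the entries of `U`
generate the splitting field. -/
theorem frobeniusSplittingField_eq_adjoin (B : Matrix ι ι L)
    (U : Matrix ι ι (AlgebraicClosure L)) (hU : IsUnit U.det)
    (h : B.map (algebraMap L (AlgebraicClosure L)) * U.map (· ^ p) = U) :
    frobeniusSplittingField p B =
      IntermediateField.adjoin L (Set.range fun s : ι × ι => U s.1 s.2) := by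
  apply le_antisymm
  · rw [frobeniusSplittingField, IntermediateField.adjoin_le_iff]
    rintro _ ⟨X, hX, i, rfl⟩
    have hU' := (Matrix.isUnit_iff_isUnit_det U).2 hU
    set Y := U⁻¹.mulVec X with hYdef
    have hY : U.mulVec Y = X := by
      rw [hYdef, Matrix.mulVec_mulVec, Matrix.mul_nonsing_inv _ hU, Matrix.one_mulVec]
    have h1 : U.mulVec (fun i => Y i ^ p) = U.mulVec Y := by
      conv_rhs => rw [hY, ← show _ = X from hX, ← hY, frobeniusMap_mulVec, h]
    have h2 := Matrix.mulVec_injective_of_isUnit hU' h1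
    rw [← hY]
    refine sum_mem fun j _ => mul_mem ?_ ?_
    · exact IntermediateField.subset_adjoin _ _ ⟨(i, j), rfl⟩
    · obtain ⟨c, hc⟩ := exists_algebraMap_eq_of_pow_eq p (congrFun h2 j)
      rw [← hc, IsScalarTower.algebraMap_apply (ZMod p) L]
      exact IntermediateField.algebraMap_mem _ _
  · rw [IntermediateField.adjoin_le_iff]
    rintro _ ⟨⟨i, j⟩, rfl⟩
    refine IntermediateField.subset_adjoin _ _ ⟨fun i => U i j, ?_, i, rfl⟩
    ext i'
    exact congrFun (congrFun h i') j

/-- If `u` is a unit of `L̄ ⊗ E` with `a (Frob ⊗ id)(u) = u`, then the splitting field of the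
Frobenius module of the matrix of `a` is generated by the entries of the matrix of `u`. -/
theorem frobeniusSplittingField_baseMulMatrix {E : Type*} [Field E] [Algebra (ZMod p) E]
    (b : Module.Basis ι (ZMod p) E) (a : L ⊗[ZMod p] E)
    (u : AlgebraicClosure L ⊗[ZMod p] E) (hu : IsUnit u)
    (h : extendHom E (IsScalarTower.toAlgHom (ZMod p) L (AlgebraicClosure L)) a *
      frobTensor p E _ u = u) :
    frobeniusSplittingField p (baseMulMatrix L b a) =
      IntermediateField.adjoin L
        (Set.range fun s : ι × ι => baseMulMatrix (AlgebraicClosure L) b u s.1 s.2) := by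
  apply frobeniusSplittingField_eq_adjoin _ _ (isUnit_det_baseMulMatrix b hu)
  conv_rhs => rw [← h, map_mul, baseMulMatrix_extendHom, baseMulMatrix_frobTensor]
  rfl

end FrobeniusModule

/-! ### Specializations of the general matrix -/

section Specialization

variable {k E ι : Type*} [Field k] [Field E] [Algebra k E] [Fintype ι] [DecidableEq ι]

theorem mulMatrix_X_pow_map {S : Type*} [CommRing S] [Algebra k S] (b : Module.Basis ι k E)
    (d : ℕ) (f : MvPolynomial ι k →ₐ[k] S) :
    (mulMatrix b (MvPolynomial.X (R := k)) ^ d).map f =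
      mulMatrix b (fun i => f (MvPolynomial.X i)) ^ d := by
  have h : (mulMatrix b (MvPolynomial.X (R := k))).map f =
      mulMatrix b (fun i => f (MvPolynomial.X i)) := by
    ext i j
    simp [mulMatrix, Matrix.sum_apply]
  rw [← h]
  exact map_pow (f : MvPolynomial ι k →+* S).mapMatrix _ _

/-- Specializing a power of the general matrix at `ξ` gives the same power of the matrix of the
element with coordinates `ξ`; it is defined everywhere, the entries being polynomials. -/
theorem isSpecialization_generalMatrix_pow {L : Type*} [Field L] [Algebra k L]
    (b : Module.Basis ι k E) (d : ℕ) (ξ : ι → L) :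
    IsSpecialization (generalMatrix b ^ d) ξ (mulMatrix b ξ ^ d) := by
  intro i j
  refine ⟨(mulMatrix b (MvPolynomial.X (R := k)) ^ d) i j, 1, by simp, ?_, ?_⟩
  · rw [map_one, div_one]
    exact (congrFun (congrFun (mulMatrix_X_pow_map b d
      (IsScalarTower.toAlgHom k (MvPolynomial ι k) (FractionRing (MvPolynomial ι k)))) i) j).symm
  · have := congrFun (congrFun (mulMatrix_X_pow_map b d (MvPolynomial.aeval ξ)) i) j
    simp only [MvPolynomial.aeval_X] at this
    rw [map_one, div_one, ← this]
    rfl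

end Specialization

/-! ### Hilbert 90 and the realization of cyclic extensions -/

section Galois

variable {p : ℕ} [Fact p.Prime] {E : Type*} [Field E] [Algebra (ZMod p) E]
variable {L M : Type*} [Field L] [Field M] [Algebra (ZMod p) L] [Algebra (ZMod p) M] [Algebra L M]
  [IsScalarTower (ZMod p) L M]

variable (E) in
/-- The action of an automorphism of `M / L` on `M ⊗ E` through the first factor. -/
noncomputable def galTensor (γ : M ≃ₐ[L] M) : M ⊗[ZMod p] E →ₐ[ZMod p] M ⊗[ZMod p] E :=
  extendHom E ((γ : M →ₐ[L] M).restrictScalars (ZMod p))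

@[simp]
theorem galTensor_tmul (γ : M ≃ₐ[L] M) (x : M) (e : E) :
    galTensor E γ (x ⊗ₜ[ZMod p] e) = γ x ⊗ₜ e := by
  simp [galTensor]

theorem frobTensor_galTensor (γ : M ≃ₐ[L] M) (x : M ⊗[ZMod p] E) :
    frobTensor p E M (galTensor E γ x) = galTensor E γ (frobTensor p E M x) :=
  frobTensor_extendHom p _ x

variable {ι : Type*} [Fintype ι] [DecidableEq ι]

theorem baseMulMatrix_galTensor (b : Module.Basis ι (ZMod p) E) (γ : M ≃ₐ[L] M)
    (x : M ⊗[ZMod p] E) : baseMulMatrix M b (galTensor E γ x) = (baseMulMatrix M b x).map γ :=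
  baseMulMatrix_extendHom b _ x

variable [FiniteDimensional L M] [IsGalois L M]

theorem exists_extendHom_eq_of_galTensor_eq [FiniteDimensional (ZMod p) E] {x : M ⊗[ZMod p] E}
    (h : ∀ γ : M ≃ₐ[L] M, galTensor E γ x = x) :
    ∃ y, extendHom E (IsScalarTower.toAlgHom (ZMod p) L M) y = x := by
  let b := Module.finBasis (ZMod p) E
  refine exists_extendHom_eq b _ x fun i => ?_
  refine (IsGalois.mem_range_algebraMap_iff_fixed (F := L) _).2 fun γ => ?_
  conv_rhs => rw [← h γ]
  exact (repr_extendHom b ((γ : M →ₐ[L] M).restrictScalars (ZMod p)) x i).symm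

/-- Hilbert's Theorem 90 for the torus `Res_{E/𝔽_p} 𝔾_m` and a character of the Galois group:
the resolvent `∑ γ, γ θ ⊗ χ γ⁻¹` of a normal basis generator `θ` is a unit of `M ⊗ E`. This also
covers finite fields `L`, for which a general position argument would fail. -/
theorem exists_isUnit_galTensor_eq [FiniteDimensional (ZMod p) E] (χ : (M ≃ₐ[L] M) →* E) :
    ∃ v : M ⊗[ZMod p] E, IsUnit v ∧ ∀ γ : M ≃ₐ[L] M, galTensor E γ v = (1 ⊗ₜ χ γ) * v := by
  classical
  let b := Module.finBasis (ZMod p) E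
  obtain ⟨θ, hθ⟩ := exists_linearIndependent_algEquiv_apply L M
  let v : M ⊗[ZMod p] E := ∑ δ : M ≃ₐ[L] M, δ θ ⊗ₜ χ δ⁻¹
  have hv : ∀ γ : M ≃ₐ[L] M, galTensor E γ v = (1 ⊗ₜ χ γ) * v := by
    intro γ
    simp only [v, map_sum, galTensor_tmul, Finset.mul_sum, Algebra.TensorProduct.tmul_mul_tmul,
      one_mul, ← map_mul]
    refine Fintype.sum_equiv (Equiv.mulLeft γ) _ _ fun δ => ?_
    rw [Equiv.coe_mulLeft, AlgEquiv.mul_apply, mul_inv_rev, map_mul, map_mul, mul_left_comm,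
      ← map_mul, mul_inv_cancel, map_one, mul_one]
  refine ⟨v, isUnit_of_isUnit_det_baseMulMatrix b v (isUnit_iff_ne_zero.2 fun h0 => ?_), hv⟩
  set V := baseMulMatrix M b v with hV
  obtain ⟨w, hw0, hw⟩ := Matrix.exists_mulVec_eq_zero_iff.2 h0
  -- The kernel of `V` is stable under the Galois group.
  have hker : ∀ (γ : M ≃ₐ[L] M) (c : M), V.mulVec (fun j => γ (c * w j)) = 0 := by
    intro γ c
    have h1 : (baseMulMatrix M b (1 ⊗ₜ[ZMod p] χ γ)).mulVec
        (V.mulVec fun j => γ (c * w j)) = 0 := by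
      rw [Matrix.mulVec_mulVec, hV, ← map_mul, ← hv, baseMulMatrix_galTensor]
      ext i
      have h2 : γ (c * (V.mulVec w) i) = 0 := by simp [hw]
      rw [Pi.zero_apply, ← h2]
      simp only [Matrix.mulVec, dotProduct, Matrix.map_apply, Finset.mul_sum, map_sum, ← hV]
      refine Finset.sum_congr rfl fun j _ => ?_
      rw [← map_mul]
      congr 1
      ring
    have h3 : IsUnit (baseMulMatrix M b (1 ⊗ₜ[ZMod p] χ γ)) :=
      (((Group.isUnit γ).map χ).map (Algebra.TensorProduct.includeRight :
        E →ₐ[ZMod p] M ⊗[ZMod p] E)).map _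
    exact Matrix.mulVec_injective_of_isUnit h3 (h1.trans (Matrix.mulVec_zero _).symm)
  -- Taking a trace yields a nonzero vector of the kernel with coordinates in `L`.
  obtain ⟨i, hi⟩ := Function.ne_iff.1 hw0
  obtain ⟨c, hc⟩ : ∃ c : M, Algebra.trace L M (c * w i) ≠ 0 := by
    obtain ⟨t, ht⟩ := Algebra.trace_surjective L M 1
    exact ⟨t * (w i)⁻¹, by rw [inv_mul_cancel_right₀ hi, ht]; exact one_ne_zero⟩
  have hl : V.mulVec (fun j => algebraMap L M (Algebra.trace L M (c * w j))) = 0 := by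
    have : (fun j => algebraMap L M (Algebra.trace L M (c * w j))) =
        ∑ γ : M ≃ₐ[L] M, fun j => γ (c * w j) := by
      ext j
      rw [trace_eq_sum_automorphisms, Finset.sum_apply]
    rw [this, Matrix.mulVec_sum]
    exact Finset.sum_eq_zero fun γ _ => hker γ c
  -- By independence of the conjugates of `θ`, this vector is killed by the matrix of each `χ δ⁻¹`,
  -- in particular by that of `χ 1 = 1`.
  have h4 := congrFun hl i
  have h5 : ∑ δ : M ≃ₐ[L] M, (∑ j, algebraMap (ZMod p) L (Algebra.leftMulMatrix b (χ δ⁻¹) i j) *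
      Algebra.trace L M (c * w j)) • δ θ = 0 := by
    rw [← show _ = (0 : M) from h4]
    simp only [V, v, map_sum, baseMulMatrix_tmul, Matrix.mulVec, dotProduct, Matrix.sum_apply,
      Matrix.smul_apply, Matrix.map_apply, Finset.sum_mul, smul_eq_mul, Finset.sum_smul]
    rw [Finset.sum_comm]
    refine Finset.sum_congr rfl fun j _ => Finset.sum_congr rfl fun δ _ => ?_
    rw [Algebra.smul_def, map_mul, ← IsScalarTower.algebraMap_apply]
    ring
  have h6 := Fintype.linearIndependent_iff.1 hθ _ h5 1
  simp [Matrix.one_apply] at h6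
  exact hc h6

/-- A finite Galois extension `M / L` whose Galois group has a character `χ` to `Eˣ` with `χ ^ d`
injective is the splitting field of the `d`-th power of a specialized general matrix. -/
theorem exists_splittingField_mulMatrix_pow (b : Module.Basis ι (ZMod p) E) (d : ℕ)
    (χ : (M ≃ₐ[L] M) →* E) (hχ : Function.Injective fun γ => χ γ ^ d) :
    ∃ ξ : ι → L, IsUnit (mulMatrix b ξ ^ d).det ∧
      Nonempty (M ≃ₐ[L] frobeniusSplittingField p (mulMatrix b ξ ^ d)) := by
  have : FiniteDimensional (ZMod p) E := b.finiteDimensional_of_finite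
  obtain ⟨v, hv, hvγ⟩ := exists_isUnit_galTensor_eq (p := p) χ
  have hφv : IsUnit (frobTensor p E M v) := hv.map _
  obtain ⟨w, hw⟩ := hφv.exists_right_inv
  have hvw : v * w * frobTensor p E M v = v := by rw [mul_assoc, mul_comm w, hw, mul_one]
  obtain ⟨a, ha⟩ : ∃ a, extendHom E (IsScalarTower.toAlgHom (ZMod p) L M) a = v * w := by
    refine exists_extendHom_eq_of_galTensor_eq fun γ => ?_
    have hu : IsUnit (1 ⊗ₜ[ZMod p] χ γ : M ⊗[ZMod p] E) :=
      ((Group.isUnit γ).map χ).map (Algebra.TensorProduct.includeRight :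
        E →ₐ[ZMod p] M ⊗[ZMod p] E)
    have h1 := congrArg (galTensor E γ) hvw
    rw [map_mul _ (v * w), ← frobTensor_galTensor, hvγ, map_mul (frobTensor p E M),
      frobTensor_tmul, one_pow] at h1
    apply (hu.mul hφv).mul_right_cancel
    rw [h1, mul_left_comm, hvw]
  let ξ : ι → L := fun i => (Algebra.TensorProduct.basis L b).repr a i
  have hξ : mulMatrix b ξ ^ d = baseMulMatrix L b (a ^ d) := by
    rw [map_pow, baseMulMatrix_eq_mulMatrix]
  have haunit : IsUnit (baseMulMatrix L b a).det := by
    have h1 : IsUnit (v * w) := IsUnit.of_mul_eq_one (frobTensor p E M v * ↑hv.unit⁻¹) (by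
      rw [← mul_assoc, hvw, IsUnit.mul_val_inv])
    rw [← ha] at h1
    exact isUnit_det_baseMulMatrix b (isUnit_of_isUnit_extendHom b _ h1)
  refine ⟨ξ, by rw [Matrix.det_pow, ← baseMulMatrix_eq_mulMatrix]; exact haunit.pow d, ?_⟩
  let j : M →ₐ[L] AlgebraicClosure L := IsAlgClosed.lift
  let j' := j.restrictScalars (ZMod p)
  have hj : j'.comp (IsScalarTower.toAlgHom (ZMod p) L M) =
      IsScalarTower.toAlgHom (ZMod p) L (AlgebraicClosure L) := by
    ext x
    exact j.commutes x
  have hsplit := frobeniusSplittingField_baseMulMatrix b (a ^ d) (extendHom E j' (v ^ d))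
    ((hv.pow d).map _) (by
      rw [← hj, ← extendHom_comp_apply, map_pow _ a d, ha, frobTensor_extendHom, ← map_mul,
        map_pow, ← mul_pow, hvw])
  have htop : IntermediateField.adjoin L
      (Set.range fun s : ι × ι => baseMulMatrix M b (v ^ d) s.1 s.2) = ⊤ := by
    rw [← IsGalois.fixedField_fixingSubgroup (IntermediateField.adjoin L _),
      ← IntermediateField.fixedField_bot]
    congr 1
    rw [eq_bot_iff]
    intro γ hγ
    rw [IntermediateField.mem_fixingSubgroup_iff] at hγ
    have h1 : galTensor E γ (v ^ d) = v ^ d := by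
      apply baseMulMatrix_injective b
      rw [baseMulMatrix_galTensor]
      ext i i'
      exact hγ _ (IntermediateField.subset_adjoin _ _ ⟨(i, i'), rfl⟩)
    rw [map_pow, hvγ, mul_pow, Algebra.TensorProduct.tmul_pow, one_pow] at h1
    have h2 : (1 ⊗ₜ (χ γ ^ d) : M ⊗[ZMod p] E) = 1 ⊗ₜ 1 :=
      (hv.pow d).mul_right_cancel (by rw [h1, ← Algebra.TensorProduct.one_def, one_mul])
    have h3 := one_tmul_injective p h2
    exact hχ (by simpa using h3)
  have himage : (Set.range fun s : ι × ι => baseMulMatrix (AlgebraicClosure L) b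
      (extendHom E j' (v ^ d)) s.1 s.2) =
      j '' Set.range fun s : ι × ι => baseMulMatrix M b (v ^ d) s.1 s.2 := by
    rw [← Set.range_comp, baseMulMatrix_extendHom]
    rfl
  rw [himage, ← IntermediateField.adjoin_map, htop, ← AlgHom.fieldRange_eq_map] at hsplit
  rw [hξ, hsplit]
  exact ⟨AlgEquiv.ofInjectiveField j⟩

end Galois

/-! ### Lang's theorem for the Weil restriction of the multiplicative group -/

section Lang

variable {p : ℕ} [Fact p.Prime] {E : Type*} [Field E] [Algebra (ZMod p) E]
variable {Ω : Type*} [Field Ω] [Algebra (ZMod p) Ω]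

/-- The homomorphism `r ⊗ e ↦ r τ(e) ^ p ^ j`. For `0 ≤ j < [E : 𝔽_p]` these are the coordinate
projections of the splitting `Ω ⊗ E ≃ Ωⁿ`. -/
noncomputable def conjEval (τ : E →ₐ[ZMod p] Ω) (j : ℕ) : Ω ⊗[ZMod p] E →ₐ[ZMod p] Ω :=
  Algebra.TensorProduct.productMap (AlgHom.id (ZMod p) Ω)
    (τ.comp (FiniteField.frobeniusAlgHom (ZMod p) E ^ j))

@[simp]
theorem conjEval_tmul (τ : E →ₐ[ZMod p] Ω) (j : ℕ) (r : Ω) (e : E) :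
    conjEval τ j (r ⊗ₜ e) = r * τ e ^ p ^ j := by
  simp [conjEval, AlgHom.coe_pow, FiniteField.coe_frobeniusAlgHom, pow_iterate]

theorem conjEval_succ_frobTensor (τ : E →ₐ[ZMod p] Ω) (j : ℕ) (x : Ω ⊗[ZMod p] E) :
    conjEval τ (j + 1) (frobTensor p E Ω x) = conjEval τ j x ^ p := by
  have : CharP Ω p := charP_of_injective_algebraMap (algebraMap (ZMod p) Ω).injective p
  induction x with
  | zero => simp [(Fact.out : p.Prime).ne_zero]
  | tmul r e => rw [frobTensor_tmul, conjEval_tmul, conjEval_tmul, mul_pow, ← pow_mul, pow_succ]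
  | add x y hx hy => rw [map_add, map_add, map_add, hx, hy, add_pow_char]

variable {n : ℕ}

theorem pow_pow_eq_self_of_basis (b : Module.Basis (Fin n) (ZMod p) E) (e : E) :
    e ^ p ^ n = e := by
  have : Module.Finite (ZMod p) E := b.finiteDimensional_of_finite
  have : Finite E := Module.finite_of_finite (ZMod p)
  have := Fintype.ofFinite E
  have h := FiniteField.pow_card e
  rwa [Module.card_fintype b, ZMod.card, Fintype.card_fin] at h

theorem conjEval_add_period (b : Module.Basis (Fin n) (ZMod p) E) (τ : E →ₐ[ZMod p] Ω) (j : ℕ) :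
    conjEval τ (j + n) = conjEval τ j := by
  apply Algebra.TensorProduct.ext'
  intro r e
  rw [conjEval_tmul, conjEval_tmul, ← map_pow, ← map_pow, add_comm, pow_add, pow_mul,
    pow_pow_eq_self_of_basis b]

/-- The Moore matrix of a basis of `E / 𝔽_p` is invertible: a relation between its rows is an
additive polynomial of degree less than `|E|` vanishing on `E`. -/
theorem det_moore_ne_zero (b : Module.Basis (Fin n) (ZMod p) E) (τ : E →ₐ[ZMod p] Ω) :
    (Matrix.of fun j i : Fin n => τ (b i) ^ p ^ (j : ℕ)).det ≠ 0 := by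
  have : CharP Ω p := charP_of_injective_algebraMap (algebraMap (ZMod p) Ω).injective p
  have : Module.Finite (ZMod p) E := b.finiteDimensional_of_finite
  have : Finite E := Module.finite_of_finite (ZMod p)
  have := Fintype.ofFinite E
  have hp1 : 1 < p := (Fact.out : p.Prime).one_lt
  intro h0
  obtain ⟨c, hc0, hc⟩ := Matrix.exists_vecMul_eq_zero_iff.2 h0
  let P : Polynomial Ω := ∑ j : Fin n, Polynomial.C (c j) * Polynomial.X ^ p ^ (j : ℕ)
  have hcoeff : ∀ j : Fin n, P.coeff (p ^ (j : ℕ)) = c j := by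
    intro j
    simp only [P, Polynomial.finsetSum_coeff, Polynomial.coeff_C_mul, Polynomial.coeff_X_pow]
    rw [Finset.sum_eq_single j]
    · simp
    · intro i _ hij
      rw [if_neg, mul_zero]
      exact fun h => hij (Fin.ext (Nat.pow_right_injective hp1 h).symm)
    · simp
  let f : E →ₗ[ZMod p] Ω := ∑ j : Fin n, (LinearMap.mulLeft (ZMod p) (c j)).comp
    (τ.comp (FiniteField.frobeniusAlgHom (ZMod p) E ^ (j : ℕ))).toLinearMap
  have hfP : ∀ e, P.eval (τ e) = f e := by
    intro e
    simp [P, f, Polynomial.eval_finsetSum, AlgHom.coe_pow, FiniteField.coe_frobeniusAlgHom,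
      pow_iterate]
  have hf : f = 0 := by
    refine b.ext fun i => ?_
    have := congrFun hc i
    rw [← hfP]
    simpa [P, Polynomial.eval_finsetSum, Matrix.vecMul, dotProduct] using this
  have hP : P = 0 := by
    refine Polynomial.eq_zero_of_natDegree_lt_card_of_eval_eq_zero P (f := τ) τ.injective
      (fun e => by rw [hfP, hf, LinearMap.zero_apply]) ?_
    rw [Module.card_fintype b, ZMod.card, Fintype.card_fin]
    rcases Nat.eq_zero_or_pos n with rfl | hn
    · simp [P]
    refine lt_of_le_of_lt (Polynomial.natDegree_sum_le_of_forall_le _ _ (n := p ^ (n - 1))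
      fun j _ => ?_) (Nat.pow_lt_pow_right hp1 (Nat.sub_one_lt hn.ne'))
    exact (Polynomial.natDegree_C_mul_X_pow_le _ _).trans
      (Nat.pow_le_pow_right hp1.le (Nat.le_sub_one_of_lt j.2))
  exact hc0 (funext fun j => by rw [← hcoeff, hP, Polynomial.coeff_zero, Pi.zero_apply])

theorem conjEval_eq_mulVec (b : Module.Basis (Fin n) (ZMod p) E) (τ : E →ₐ[ZMod p] Ω)
    (x : Ω ⊗[ZMod p] E) (j : Fin n) :
    conjEval τ j x = (Matrix.of fun j i : Fin n => τ (b i) ^ p ^ (j : ℕ)).mulVec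
      ((Algebra.TensorProduct.basis Ω b).repr x) j := by
  conv_lhs => rw [← sum_repr_tmul b x]
  simp [Matrix.mulVec, dotProduct, mul_comm]

theorem eq_of_conjEval_eq (b : Module.Basis (Fin n) (ZMod p) E) (τ : E →ₐ[ZMod p] Ω)
    {x y : Ω ⊗[ZMod p] E} (h : ∀ j < n, conjEval τ j x = conjEval τ j y) : x = y := by
  have hM := (Matrix.isUnit_iff_isUnit_det _).2 (isUnit_iff_ne_zero.2 (det_moore_ne_zero b τ))
  apply (Algebra.TensorProduct.basis Ω b).repr.injective
  apply DFunLike.coe_injective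
  apply Matrix.mulVec_injective_of_isUnit hM
  ext j
  rw [← conjEval_eq_mulVec, ← conjEval_eq_mulVec, h j j.2]

theorem exists_conjEval_eq (b : Module.Basis (Fin n) (ZMod p) E) (τ : E →ₐ[ZMod p] Ω)
    (x : ℕ → Ω) : ∃ z : Ω ⊗[ZMod p] E, ∀ j < n, conjEval τ j z = x j := by
  have hM := (Matrix.isUnit_iff_isUnit_det _).2 (isUnit_iff_ne_zero.2 (det_moore_ne_zero b τ))
  obtain ⟨w, hw⟩ := Matrix.mulVec_surjective_iff_isUnit.2 hM fun j => x j
  obtain ⟨z, hz⟩ := (Algebra.TensorProduct.basis Ω b).equivFun.surjective w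
  refine ⟨z, fun j hj => ?_⟩
  rw [Module.Basis.equivFun_apply] at hz
  have := conjEval_eq_mulVec b τ z ⟨j, hj⟩
  rw [hz, hw] at this
  exact this

theorem eq_of_conjEval_succ_eq (b : Module.Basis (Fin n) (ZMod p) E) (τ : E →ₐ[ZMod p] Ω)
    {x y : Ω ⊗[ZMod p] E} (h : ∀ j < n, conjEval τ (j + 1) x = conjEval τ (j + 1) y) : x = y := by
  refine eq_of_conjEval_eq b τ fun j hj => ?_
  rcases j with _ | j
  · rw [← conjEval_add_period b]
    obtain ⟨m, rfl⟩ := Nat.exists_eq_succ_of_ne_zero hj.ne'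
    have := h m (Nat.lt_succ_self m)
    simpa using this
  · exact h j (by omega)

/-- A solution of `a (Frob ⊗ id)(u) = u` satisfies `N u ^ (p ^ n) = u`, where
`N = ∏ j < n, (Frob ⊗ id)^j a`. -/
theorem prod_frobTensor_mul_pow {R : Type*} [CommRing R] [Algebra (ZMod p) R]
    (b : Module.Basis (Fin n) (ZMod p) E) {a u : R ⊗[ZMod p] E}
    (h : a * frobTensor p E R u = u) :
    (∏ j ∈ Finset.range n, (frobTensor p E R)^[j] a) * u ^ p ^ n = u := by
  rw [← iterate_frobTensor_eq_pow p n (pow_pow_eq_self_of_basis b)]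
  generalize n = m
  induction m with
  | zero => simp
  | succ m ih =>
    rw [Finset.prod_range_succ, Function.iterate_succ_apply, mul_assoc, ← iterate_map_mul, h, ih]

/-- Lang's theorem for the torus `Res_{E/𝔽_p} 𝔾_m`, over a separably closed field. In the
coordinates `conjEval τ j` the equation reads `x (j + 1) = a (j + 1) * x j ^ p` with `j` modulo
`n`, so that only `x n = x 0` has to be solved, a separable equation for `x 0`. -/
theorem exists_isUnit_mul_frobTensor_eq [IsSepClosed Ω] (hn : 0 < n)
    (b : Module.Basis (Fin n) (ZMod p) E) (τ : E →ₐ[ZMod p] Ω) {a : Ω ⊗[ZMod p] E}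
    (ha : IsUnit a) : ∃ u : Ω ⊗[ZMod p] E, IsUnit u ∧ a * frobTensor p E Ω u = u := by
  have : CharP Ω p := charP_of_injective_algebraMap (algebraMap (ZMod p) Ω).injective p
  have ha0 : ∀ j, conjEval τ j a ≠ 0 := fun j => (ha.map (conjEval τ j)).ne_zero
  -- The recursion gives `x j = c j * t ^ p ^ j` in terms of `t = x 0`; then `x n = x 0` amounts to
  -- `t ^ (p ^ n - 1) = (c n)⁻¹`.
  let c : ℕ → Ω := Nat.rec 1 fun j y => conjEval τ (j + 1) a * y ^ p
  have hc0 : ∀ j, c j ≠ 0 := by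
    intro j
    induction j with
    | zero => exact one_ne_zero
    | succ j ih => exact mul_ne_zero (ha0 _) (pow_ne_zero _ ih)
  have hpn : 0 < p ^ n := pow_pos (Fact.out : p.Prime).pos n
  have : NeZero ((p ^ n - 1 : ℕ) : Ω) := ⟨by
    rw [Nat.cast_sub hpn, Nat.cast_pow, CharP.cast_eq_zero, zero_pow hn.ne', Nat.cast_one,
      zero_sub]
    exact neg_ne_zero.2 one_ne_zero⟩
  obtain ⟨t, ht⟩ := IsSepClosed.exists_pow_nat_eq (c n)⁻¹ (p ^ n - 1)
  have ht0 : t ≠ 0 := by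
    rintro rfl
    rw [zero_pow (fun h => this.out (by rw [h, Nat.cast_zero]))] at ht
    exact inv_ne_zero (hc0 n) ht.symm
  let x : ℕ → Ω := fun j => c j * t ^ p ^ j
  have hx0 : ∀ j, x j ≠ 0 := fun j => mul_ne_zero (hc0 j) (pow_ne_zero _ ht0)
  have hxs : ∀ j, x (j + 1) = conjEval τ (j + 1) a * x j ^ p := by
    intro j
    change conjEval τ (j + 1) a * c j ^ p * t ^ p ^ (j + 1) = _ * (c j * t ^ p ^ j) ^ p
    rw [mul_pow, ← pow_mul, ← pow_succ, mul_assoc]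
  have hxn : x n = x 0 := by
    change c n * t ^ p ^ n = 1 * t ^ p ^ 0
    rw [← Nat.sub_add_cancel hpn, pow_succ, ht, ← mul_assoc, mul_inv_cancel₀ (hc0 n), pow_zero,
      pow_one]
  obtain ⟨u, hu⟩ := exists_conjEval_eq b τ x
  have hu' : ∀ j ≤ n, conjEval τ j u = x j := by
    intro j hj
    rcases hj.lt_or_eq with hj | rfl
    · exact hu j hj
    · rw [hxn, ← hu 0 hn, ← conjEval_add_period b τ 0, zero_add]
  have h : a * frobTensor p E Ω u = u := by
    refine eq_of_conjEval_succ_eq b τ fun j hj => ?_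
    rw [map_mul, conjEval_succ_frobTensor, hu' j hj.le, hu' (j + 1) hj, hxs]
  refine ⟨u, ?_, h⟩
  have h1 := prod_frobTensor_mul_pow b h
  set N := ∏ j ∈ Finset.range n, (frobTensor p E Ω)^[j] a
  have h2 : u * (N * u ^ (p ^ n - 2)) = 1 := by
    have hp2 : 2 ≤ p ^ n := (Fact.out : p.Prime).two_le.trans
      (Nat.le_self_pow hn.ne' p)
    refine eq_of_conjEval_eq b τ fun j hj => ?_
    have h3 := congrArg (conjEval τ j) h1
    have h4 : conjEval τ j u ≠ 0 := by rw [hu j hj]; exact hx0 j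
    apply mul_left_cancel₀ h4
    rw [map_one, mul_one, ← map_mul]
    refine Eq.trans (congrArg _ ?_) h3
    obtain ⟨k, hk⟩ := Nat.exists_eq_add_of_le' hp2
    rw [hk, Nat.add_sub_cancel]
    ring
  exact IsUnit.of_mul_eq_one _ h2

end Lang

/-! ### The Galois group of the splitting field -/

section GaloisGroup

variable {p : ℕ} [Fact p.Prime] {E : Type*} [Field E] [Algebra (ZMod p) E]

/-- Let `w` be a unit of `S ⊗ E` solving `a (Frob ⊗ id)(w) = w` and not fixed by any nontrivial
automorphism of `S / K`. Then `γ w / w ∈ E` defines an injective character of the Galois group. If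
`w ^ 2 ^ m = N⁻¹`, its order divides `2 ^ m`; it cannot divide `2 ^ (m - 1)`, as otherwise
`w ^ 2 ^ (m - 1)` would be a square root of `N⁻¹` defined over `K`. -/
theorem nonempty_galoisGroup_mulEquiv [FiniteDimensional (ZMod p) E]
    {K S : Type*} [Field K] [Field S] [Algebra (ZMod p) K] [Algebra (ZMod p) S] [Algebra K S]
    [IsScalarTower (ZMod p) K S] [FiniteDimensional K S] [IsGalois K S] {m : ℕ} (hm : m ≠ 0)
    {a N : K ⊗[ZMod p] E} {w : S ⊗[ZMod p] E} (hw : IsUnit w)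
    (h : extendHom E (IsScalarTower.toAlgHom (ZMod p) K S) a * frobTensor p E S w = w)
    (hgen : ∀ γ : S ≃ₐ[K] S, galTensor E γ w = w → γ = 1)
    (hwN : w ^ 2 ^ m * extendHom E (IsScalarTower.toAlgHom (ZMod p) K S) N = 1)
    (hN : ∀ y : K ⊗[ZMod p] E, y ^ 2 * N ≠ 1) :
    Nonempty ((S ≃ₐ[K] S) ≃* Multiplicative (ZMod (2 ^ m))) := by
  have hfix : ∀ (γ : S ≃ₐ[K] S) (x : K ⊗[ZMod p] E),
      galTensor E γ (extendHom E (IsScalarTower.toAlgHom (ZMod p) K S) x) =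
        extendHom E (IsScalarTower.toAlgHom (ZMod p) K S) x := by
    intro γ x
    have h1 : ((γ : S →ₐ[K] S).restrictScalars (ZMod p)).comp
        (IsScalarTower.toAlgHom (ZMod p) K S) = IsScalarTower.toAlgHom (ZMod p) K S :=
      AlgHom.ext γ.commutes
    rw [galTensor, extendHom_comp_apply, h1]
  have hex : ∀ γ : S ≃ₐ[K] S, ∃ e : E, galTensor E γ w = (1 ⊗ₜ e) * w := by
    intro γ
    obtain ⟨w', hw'⟩ := hw.exists_right_inv
    have h1 : galTensor E γ w * w' * w = galTensor E γ w := by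
      rw [mul_assoc, mul_comm w', hw', mul_one]
    obtain ⟨e, he⟩ := exists_one_tmul_eq_of_frobTensor_eq p (x := galTensor E γ w * w') (by
      have h2 := congrArg (galTensor E γ) h
      rw [map_mul, hfix, ← frobTensor_galTensor, ← h1, map_mul (frobTensor p E S),
        mul_left_comm, h] at h2
      exact hw.mul_right_cancel h2)
    exact ⟨e, by rw [he, h1]⟩
  have huniq : ∀ {e e' : E}, (1 ⊗ₜ e : S ⊗[ZMod p] E) * w = (1 ⊗ₜ e') * w → e = e' :=
    fun he => one_tmul_injective p (hw.mul_right_cancel he)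
  choose f hf using hex
  let ψ : (S ≃ₐ[K] S) →* E :=
    { toFun := f
      map_one' := by
        apply huniq
        rw [← hf, ← Algebra.TensorProduct.one_def, one_mul]
        have : galTensor E (1 : S ≃ₐ[K] S) = AlgHom.id (ZMod p) _ := by
          apply Algebra.TensorProduct.ext'
          intro r e
          simp
        rw [this, AlgHom.id_apply]
      map_mul' := fun γ δ => by
        apply huniq
        have : galTensor E (γ * δ) w = galTensor E γ (galTensor E δ w) := by
          rw [galTensor, galTensor, galTensor, extendHom_comp_apply]
          rfl
        rw [← hf, this, hf, map_mul, hf, galTensor_tmul, map_one, ← mul_assoc,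
          Algebra.TensorProduct.tmul_mul_tmul, mul_one, mul_comm (f δ)] }
  have hψ : Function.Injective ψ := by
    rw [injective_iff_map_eq_one]
    intro γ hγ
    apply hgen
    rw [hf, show f γ = 1 from hγ, ← Algebra.TensorProduct.one_def, one_mul]
  have hpow : ∀ (γ : S ≃ₐ[K] S) (r : ℕ), galTensor E γ (w ^ r) = (1 ⊗ₜ ψ (γ ^ r)) * w ^ r := by
    intro γ r
    rw [map_pow, hf, mul_pow, Algebra.TensorProduct.tmul_pow, one_pow, map_pow]
    rfl
  have hcyc : IsCyclic (S ≃ₐ[K] S) := isCyclic_of_injective_ringHom ψ hψ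
  have hcard : Nat.card (S ≃ₐ[K] S) ∣ 2 ^ m := by
    rw [← IsCyclic.exponent_eq_card]
    refine Monoid.exponent_dvd_of_forall_pow_eq_one fun γ => hψ ?_
    rw [map_one]
    apply one_tmul_injective (K := S) p
    apply (hw.pow (2 ^ m)).mul_right_cancel
    change (1 ⊗ₜ ψ (γ ^ 2 ^ m)) * w ^ 2 ^ m = (1 ⊗ₜ 1) * w ^ 2 ^ m
    rw [← hpow, ← Algebra.TensorProduct.one_def, one_mul]
    have h1 := congrArg (galTensor E γ) hwN
    rw [map_mul, hfix, map_one] at h1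
    have h2 : IsUnit (extendHom E (IsScalarTower.toAlgHom (ZMod p) K S) N) :=
      IsUnit.of_mul_eq_one_right _ hwN
    exact h2.mul_right_cancel (h1.trans hwN.symm)
  obtain ⟨r, hr, hcard⟩ := (Nat.dvd_prime_pow Nat.prime_two).1 hcard
  have hrm : r = m := by
    by_contra hne
    have h1 : ∀ γ : S ≃ₐ[K] S, galTensor E γ (w ^ 2 ^ (m - 1)) = w ^ 2 ^ (m - 1) := by
      intro γ
      have h2 : γ ^ 2 ^ (m - 1) = 1 := by
        rw [← orderOf_dvd_iff_pow_eq_one]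
        exact (orderOf_dvd_natCard γ).trans (hcard ▸ pow_dvd_pow 2 (by omega))
      rw [hpow, h2, map_one, ← Algebra.TensorProduct.one_def, one_mul]
    obtain ⟨y, hy⟩ := exists_extendHom_eq_of_galTensor_eq h1
    apply hN y
    apply extendHom_injective (Module.finBasis (ZMod p) E)
      (f := IsScalarTower.toAlgHom (ZMod p) K S) (algebraMap K S).injective
    rw [map_mul, map_pow, hy, map_one, ← pow_mul, ← pow_succ,
      Nat.sub_add_cancel (Nat.one_le_iff_ne_zero.2 hm), hwN]
  have : Nat.card (S ≃ₐ[K] S) = Nat.card (Multiplicative (ZMod (2 ^ m))) := by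
    rw [hcard, hrm, Nat.card_congr Multiplicative.toAdd, Nat.card_zmod]
  exact ⟨mulEquivOfCyclicCardEq this⟩

/-- Solutions of `B X^(p) = X` are permuted by the automorphisms of the algebraic closure. -/
theorem normal_frobeniusSplittingField {ι K : Type*} [Fintype ι] [Field K] (q : ℕ)
    (B : Matrix ι ι K) : Normal K (frobeniusSplittingField q B) := by
  rw [IntermediateField.normal_iff_forall_map_le]
  intro σ
  rw [frobeniusSplittingField, IntermediateField.adjoin_map, IntermediateField.adjoin_le_iff]
  rintro _ ⟨_, ⟨X, hX, i, rfl⟩, rfl⟩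
  refine IntermediateField.subset_adjoin _ _ ⟨fun i => σ (X i), ?_, i, rfl⟩
  ext i
  have h := congrArg σ (congrFun hX i)
  simp only [frobeniusMap, Matrix.mulVec, dotProduct, Matrix.map_apply, map_sum, map_mul,
    AlgHom.commutes, map_pow] at h
  exact h

/-- The product `∏ j < n, (Frob ⊗ id)^j a` of the first `n` Frobenius iterates of `a`. -/
noncomputable def frobNorm {R : Type*} [CommRing R] [Algebra (ZMod p) R] (n : ℕ)
    (a : R ⊗[ZMod p] E) : R ⊗[ZMod p] E :=
  ∏ j ∈ Finset.range n, (frobTensor p E R)^[j] a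

theorem frobNorm_extendHom {R S : Type*} [CommRing R] [Algebra (ZMod p) R] [CommRing S]
    [Algebra (ZMod p) S] (n : ℕ) (f : R →ₐ[ZMod p] S) (a : R ⊗[ZMod p] E) :
    frobNorm n (extendHom E f a) = extendHom E f (frobNorm n a) := by
  have h : Function.Semiconj (extendHom E f) (frobTensor p E R) (frobTensor p E S) :=
    fun x => (frobTensor_extendHom p f x).symm
  rw [frobNorm, frobNorm, map_prod]
  exact Finset.prod_congr rfl fun j _ => ((h.iterate_right j) a).symm

/-- The splitting field attached to `a ^ d` is cyclic of order `2 ^ m` over `K` as soon as the inverse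
of `frobNorm n a` is not a square in `K ⊗ E`. -/
theorem isGalois_and_nonempty_mulEquiv {K : Type*} [Field K] [Algebra (ZMod p) K] {n m d : ℕ}
    (hn : 0 < n) (hm : m ≠ 0) (hd : p ^ n - 1 = d * 2 ^ m)
    (b : Module.Basis (Fin n) (ZMod p) E) {a : K ⊗[ZMod p] E} (ha : IsUnit a)
    (hN : ∀ y : K ⊗[ZMod p] E, y ^ 2 * frobNorm n a ≠ 1) :
    IsGalois K (frobeniusSplittingField p (baseMulMatrix K b (a ^ d))) ∧
      Nonempty ((frobeniusSplittingField p (baseMulMatrix K b (a ^ d)) ≃ₐ[K]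
        frobeniusSplittingField p (baseMulMatrix K b (a ^ d))) ≃*
          Multiplicative (ZMod (2 ^ m))) := by
  have : FiniteDimensional (ZMod p) E := b.finiteDimensional_of_finite
  -- The torsor is trivialized over the separable closure, so that the splitting field is separable.
  have : IsSepClosed (separableClosure K (AlgebraicClosure K)) :=
    (separableClosure.isSepClosure K (AlgebraicClosure K)).sep_closed
  let Ω := AlgebraicClosure K
  let s := (separableClosure K Ω).val.restrictScalars (ZMod p)
  obtain ⟨u₀, hu₀, h₀⟩ := exists_isUnit_mul_frobTensor_eq hn b
    (IsSepClosed.lift : E →ₐ[ZMod p] separableClosure K Ω)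
    (ha.map (extendHom E (IsScalarTower.toAlgHom (ZMod p) K (separableClosure K Ω))))
  set u := extendHom E s u₀ with hu
  have huunit : IsUnit u := hu₀.map _
  have h : extendHom E (IsScalarTower.toAlgHom (ZMod p) K Ω) a * frobTensor p E Ω u = u := by
    rw [hu, frobTensor_extendHom]
    conv_rhs => rw [← h₀, map_mul, extendHom_comp_apply]
    rfl
  have hsplit := frobeniusSplittingField_baseMulMatrix b (a ^ d) (u ^ d) (huunit.pow d) (by
    rw [map_pow, map_pow, ← mul_pow, h])
  have hnormal := normal_frobeniusSplittingField p (baseMulMatrix K b (a ^ d))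
  rw [hsplit] at hnormal ⊢
  set G := Set.range fun t : Fin n × Fin n => baseMulMatrix Ω b (u ^ d) t.1 t.2 with hG
  have hsep : Algebra.IsSeparable K (IntermediateField.adjoin K G) := by
    rw [← le_separableClosure_iff, IntermediateField.adjoin_le_iff]
    rintro _ ⟨t, rfl⟩
    rw [hu, ← map_pow, baseMulMatrix_extendHom]
    exact (baseMulMatrix _ b (u₀ ^ d) t.1 t.2).2
  have hgal : IsGalois K (IntermediateField.adjoin K G) := ⟨⟩
  have hfin : FiniteDimensional K (IntermediateField.adjoin K G) :=
    IntermediateField.finiteDimensional_adjoin fun x _ => Algebra.IsIntegral.isIntegral x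
  refine ⟨hgal, ?_⟩
  let v := (IntermediateField.adjoin K G).val.restrictScalars (ZMod p)
  have hvinj : Function.Injective v := (IntermediateField.adjoin K G).val.injective
  obtain ⟨w, hw⟩ : ∃ w, extendHom E v w = u ^ d := by
    refine exists_extendHom_eq b _ _ fun i => ?_
    have : (Algebra.TensorProduct.basis Ω b).repr (u ^ d) i ∈ IntermediateField.adjoin K G := by
      rw [repr_eq_sum_baseMulMatrix]
      refine sum_mem fun j _ => mul_mem (IntermediateField.subset_adjoin _ _ ⟨(i, j), rfl⟩) ?_
      rw [IsScalarTower.algebraMap_apply (ZMod p) K]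
      exact IntermediateField.algebraMap_mem _ _
    exact ⟨⟨_, this⟩, rfl⟩
  refine nonempty_galoisGroup_mulEquiv hm (a := a ^ d) (w := w) (N := frobNorm n a)
    (isUnit_of_isUnit_extendHom b v (hw ▸ huunit.pow d)) ?_ (fun γ hγ => ?_) ?_ hN
  · apply extendHom_injective b hvinj
    rw [map_mul, ← frobTensor_extendHom, hw, extendHom_comp_apply]
    change extendHom E (IsScalarTower.toAlgHom (ZMod p) K Ω) (a ^ d) * _ = _
    rw [map_pow, map_pow, ← mul_pow, h]
  · have h1 : (γ : IntermediateField.adjoin K G →ₐ[K] IntermediateField.adjoin K G) =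
        AlgHom.id K _ := by
      apply IntermediateField.adjoin_algHom_ext
      rintro _ ⟨t, rfl⟩
      have h2 := congrFun (congrFun (congrArg (baseMulMatrix _ b) hγ) t.1) t.2
      rw [baseMulMatrix_galTensor] at h2
      have h3 : baseMulMatrix _ b w t.1 t.2 = ⟨baseMulMatrix Ω b (u ^ d) t.1 t.2,
          IntermediateField.subset_adjoin _ _ ⟨t, rfl⟩⟩ := by
        apply Subtype.ext
        exact congrFun (congrFun ((baseMulMatrix_extendHom b v w).symm.trans
          (congrArg (baseMulMatrix Ω b) hw)) t.1) t.2
      rw [Matrix.map_apply, h3] at h2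
      exact h2
    ext x
    exact congrArg Subtype.val (DFunLike.congr_fun h1 x)
  · apply extendHom_injective b hvinj
    rw [map_mul, map_pow, hw, extendHom_comp_apply, map_one]
    change _ * extendHom E (IsScalarTower.toAlgHom (ZMod p) K Ω) (frobNorm n a) = 1
    apply huunit.mul_right_cancel
    conv_rhs => rw [one_mul, ← prod_frobTensor_mul_pow b h]
    rw [← frobNorm_extendHom, frobNorm, ← pow_mul, ← hd, mul_comm (u ^ _), mul_assoc, ← pow_succ,
      Nat.sub_add_cancel (pow_pos (Fact.out : p.Prime).pos n)]

end GaloisGroup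

/-! ### The general element -/

section GeneralElement

variable {p : ℕ} [Fact p.Prime] {E : Type*} [Field E] [Algebra (ZMod p) E] {n : ℕ}
  (b : Module.Basis (Fin n) (ZMod p) E)

/-- The general element `∑ t_i ⊗ b_i` of `𝔽_p(t) ⊗ E`, whose matrix is the general matrix. -/
noncomputable def generalElement :
    FractionRing (MvPolynomial (Fin n) (ZMod p)) ⊗[ZMod p] E :=
  ∑ i, algebraMap (MvPolynomial (Fin n) (ZMod p)) _ (MvPolynomial.X i) ⊗ₜ b i

theorem generalMatrix_eq_baseMulMatrix :
    generalMatrix b = baseMulMatrix _ b (generalElement b) :=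
  mulMatrix_eq_baseMulMatrix b _

/-- The determinant is a nonzero polynomial, since it takes the value `1` at the coordinates of
`1 : E`. -/
theorem isUnit_det_generalMatrix : IsUnit (generalMatrix b).det := by
  have h1 := mulMatrix_X_pow_map b 1 (IsScalarTower.toAlgHom (ZMod p)
    (MvPolynomial (Fin n) (ZMod p)) (FractionRing (MvPolynomial (Fin n) (ZMod p))))
  have h2 := mulMatrix_X_pow_map b 1 (MvPolynomial.aeval (b.repr 1) :
    MvPolynomial (Fin n) (ZMod p) →ₐ[ZMod p] ZMod p)
  have h3 : mulMatrix b (b.repr 1) = (1 : Matrix (Fin n) (Fin n) (ZMod p)) := by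
    rw [← map_one (Algebra.leftMulMatrix b)]
    conv_rhs => rw [← b.sum_repr 1]
    simp only [mulMatrix, map_sum, map_smul]
    rfl
  simp only [pow_one, MvPolynomial.aeval_X, h3] at h1 h2
  rw [isUnit_iff_ne_zero]
  intro h0
  have h4 : algebraMap (MvPolynomial (Fin n) (ZMod p))
      (FractionRing (MvPolynomial (Fin n) (ZMod p)))
      (mulMatrix b (MvPolynomial.X (R := ZMod p))).det = 0 := by
    rw [RingHom.map_det, ← h0]
    exact congrArg Matrix.det h1
  rw [FaithfulSMul.algebraMap_eq_zero_iff] at h4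
  have h5 := congrArg Matrix.det h2
  rw [Matrix.det_one] at h5
  apply one_ne_zero (α := ZMod p)
  rw [← h5, ← map_zero (MvPolynomial.aeval (b.repr 1) :
    MvPolynomial (Fin n) (ZMod p) →ₐ[ZMod p] ZMod p), ← h4]
  exact (AlgHom.map_det _ _).symm

theorem isUnit_generalElement : IsUnit (generalElement b) :=
  isUnit_of_isUnit_det_baseMulMatrix b _
    (generalMatrix_eq_baseMulMatrix b ▸ isUnit_det_generalMatrix b)

/-- The polynomial `∑ b_i X_i ^ p ^ j` over `E`. -/
noncomputable def frobForm (j : ℕ) : MvPolynomial (Fin n) E :=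
  ∑ i, MvPolynomial.C (b i) * MvPolynomial.X i ^ p ^ j

theorem prime_frobForm_zero (hn : 0 < n) : Prime (frobForm b 0) := by
  have h : frobForm b 0 = MvPolynomial.sumSMulX (Finsupp.equivFunOnFinite.symm b) := by
    rw [MvPolynomial.sumSMulX, Finsupp.linearCombination_apply,
      Finsupp.sum_fintype _ _ (by simp)]
    simp [frobForm, MvPolynomial.smul_eq_C_mul]
  rw [h]
  refine (MvPolynomial.irreducible_sumSMulX _ ⟨⟨0, hn⟩, ?_⟩ fun r hr => ?_).prime
  · simpa using b.ne_zero _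
  · exact isUnit_of_dvd_unit (hr ⟨0, hn⟩) (isUnit_iff_ne_zero.2 (by simpa using b.ne_zero _))

theorem conjEval_add_iterate_frobTensor {Ω : Type*} [Field Ω] [Algebra (ZMod p) Ω]
    (τ : E →ₐ[ZMod p] Ω) (i j : ℕ) (x : Ω ⊗[ZMod p] E) :
    conjEval τ (i + j) ((frobTensor p E Ω)^[j] x) = conjEval τ i x ^ p ^ j := by
  induction j with
  | zero => simp
  | succ j ih =>
    rw [Function.iterate_succ_apply', ← add_assoc, conjEval_succ_frobTensor, ih, ← pow_mul,
      pow_succ]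

theorem iterate_frobTensor_sum_tmul {R : Type*} [CommRing R] [Algebra (ZMod p) R] (c : Fin n → R)
    (j : ℕ) : (frobTensor p E R)^[j] (∑ i, c i ⊗ₜ b i) = ∑ i, (c i ^ p ^ j) ⊗ₜ b i := by
  induction j with
  | zero => simp
  | succ j ih =>
    rw [Function.iterate_succ_apply', ih, map_sum]
    simp only [frobTensor_tmul, ← pow_mul, pow_succ]

/-- The linear form `∑ b_i X_i` divides none of its nontrivial Frobenius twists: there is a point
of `Eⁿ` at which it vanishes while all its other conjugates take the value `1`. -/
theorem not_frobForm_zero_dvd_prod :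
    ¬ frobForm b 0 ∣ ∏ j ∈ Finset.range (n - 1), frobForm b (j + 1) := by
  let τ := AlgHom.id (ZMod p) E
  obtain ⟨z, hz⟩ := exists_conjEval_eq b τ fun j => if j = 0 then (0 : E) else 1
  let c : Fin n → E := fun i => (Algebra.TensorProduct.basis E b).repr z i
  have hc : ∀ j, MvPolynomial.eval c (frobForm b j) =
      conjEval τ 0 ((frobTensor p E E)^[j] z) := by
    intro j
    conv_rhs => rw [← sum_repr_tmul b z, iterate_frobTensor_sum_tmul, map_sum]
    simp only [frobForm, map_sum, map_mul, MvPolynomial.eval_C, map_pow, MvPolynomial.eval_X,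
      conjEval_tmul]
    exact Finset.sum_congr rfl fun i _ => by simp [τ, c, mul_comm]
  have hj : ∀ j ∈ Finset.range (n - 1), MvPolynomial.eval c (frobForm b (j + 1)) = 1 := by
    intro j hj
    rw [Finset.mem_range] at hj
    have h1 : 0 + n = (n - (j + 1)) + (j + 1) := by omega
    rw [hc, ← conjEval_add_period b τ 0, h1, conjEval_add_iterate_frobTensor, hz _ (by omega),
      if_neg (by omega), one_pow]
  rintro h
  have h1 := map_dvd (MvPolynomial.eval c) h
  rw [map_prod, Finset.prod_congr rfl hj, Finset.prod_const_one] at h1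
  rcases Nat.eq_zero_or_pos n with rfl | hn
  · simp [frobForm] at h1
  · rw [hc, Function.iterate_zero_apply, hz 0 hn, if_pos rfl, zero_dvd_iff] at h1
    exact one_ne_zero h1

/-- The inverse of `frobNorm n` of the general element is not a square: over `E` that
element becomes a polynomial divisible exactly once by the linear form `∑ b_i X_i`. -/
theorem sq_mul_frobNorm_generalElement_ne_one (hn : 0 < n)
    (y : FractionRing (MvPolynomial (Fin n) (ZMod p)) ⊗[ZMod p] E) :
    y ^ 2 * frobNorm n (generalElement b) ≠ 1 := by
  intro h
  let Q := FractionRing (MvPolynomial (Fin n) E)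
  let g : MvPolynomial (Fin n) (ZMod p) →ₐ[ZMod p] Q :=
    (IsScalarTower.toAlgHom (ZMod p) (MvPolynomial (Fin n) E) Q).comp
      (MvPolynomial.mapAlgHom (Algebra.ofId (ZMod p) E))
  have hg : Function.Injective g :=
    (IsFractionRing.injective (MvPolynomial (Fin n) E) Q).comp
      (MvPolynomial.map_injective _ (algebraMap (ZMod p) E).injective)
  let ε : FractionRing (MvPolynomial (Fin n) (ZMod p)) ⊗[ZMod p] E →ₐ[ZMod p] Q :=
    Algebra.TensorProduct.productMap (IsFractionRing.liftAlgHom hg)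
      (IsScalarTower.toAlgHom (ZMod p) E Q)
  have hε : ∀ j, ε ((frobTensor p E _)^[j] (generalElement b)) =
      algebraMap (MvPolynomial (Fin n) E) Q (frobForm b j) := by
    intro j
    rw [generalElement, iterate_frobTensor_sum_tmul, frobForm, map_sum, map_sum]
    refine Finset.sum_congr rfl fun i _ => ?_
    rw [Algebra.TensorProduct.productMap_apply_tmul, map_pow, IsFractionRing.liftAlgHom_apply,
      IsFractionRing.lift_algebraMap, map_mul, map_pow, mul_comm]
    congr 1
    change algebraMap (MvPolynomial (Fin n) E) Q (MvPolynomial.map _ (MvPolynomial.X i)) ^ _ = _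
    rw [MvPolynomial.map_X]
  have h1 := congrArg ε h
  obtain ⟨m, rfl⟩ := Nat.exists_eq_succ_of_ne_zero hn.ne'
  rw [map_mul, map_pow, map_one, frobNorm, map_prod, Finset.prod_congr rfl fun j _ => hε j,
    Finset.prod_range_succ', ← map_prod] at h1
  have hπ := prime_frobForm_zero b hn
  have hnot := not_frobForm_zero_dvd_prod b
  rw [Nat.succ_sub_one] at hnot
  obtain ⟨f, s, hrel, hfs⟩ := 
    IsFractionRing.exists_reduced_fraction (A := MvPolynomial (Fin (m + 1)) E) (ε y)
  have hs : algebraMap (MvPolynomial (Fin (m + 1)) E) Q s ≠ 0 :=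
    IsFractionRing.to_map_ne_zero_of_mem_nonZeroDivisors s.2
  rw [← hfs, IsFractionRing.mk'_eq_div, div_pow, div_mul_eq_mul_div, div_eq_one_iff_eq
    (pow_ne_zero 2 hs), ← map_mul, ← map_pow, ← map_mul, ← map_pow] at h1
  replace h1 := IsFractionRing.injective (MvPolynomial (Fin (m + 1)) E) Q h1
  obtain ⟨r, hr⟩ := hπ.dvd_of_dvd_pow
    (show frobForm b 0 ∣ (s : MvPolynomial (Fin (m + 1)) E) ^ 2 from
      ⟨f ^ 2 * ∏ j ∈ Finset.range m, frobForm b (j + 1), by rw [← h1]; ring⟩)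
  have h2 : f ^ 2 * ∏ j ∈ Finset.range m, frobForm b (j + 1) = frobForm b 0 * r ^ 2 := by
    apply mul_left_cancel₀ hπ.ne_zero
    rw [hr] at h1
    linear_combination h1
  rcases hπ.dvd_or_dvd ⟨r ^ 2, h2⟩ with h3 | h3
  · exact hπ.not_isUnit (hrel (hπ.dvd_of_dvd_pow h3) ⟨r, hr⟩)
  · exact hnot h3

end GeneralElement

/-! ### Characters of cyclic groups with values in a finite field -/

section Characters

/-- A group isomorphic to `C_{2 ^ m}` acts on `E` through a character whose `d`-th power is
injective, if `|E| - 1 = d 2 ^ m` with `d` odd. -/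
theorem exists_monoidHom_injective_pow {E G : Type*} [Field E] [Finite E] [Group G] {m d : ℕ}
    (hd : Odd d) (hE : Nat.card E - 1 = d * 2 ^ m)
    (hG : Nonempty (G ≃* Multiplicative (ZMod (2 ^ m)))) :
    ∃ χ : G →* E, Function.Injective fun g => χ g ^ d := by
  obtain ⟨e⟩ := hG
  obtain ⟨g, hg⟩ := IsCyclic.exists_ofOrder_eq_natCard (α := Eˣ)
  rw [Nat.card_units, hE] at hg
  have hg' : orderOf (g ^ d) = 2 ^ m := by
    rw [orderOf_pow' _ hd.pos.ne', hg, Nat.gcd_mul_right_left, Nat.mul_div_cancel_left _ hd.pos]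
  have hcard : Nat.card (Multiplicative (ZMod (2 ^ m))) = Nat.card (Subgroup.zpowers (g ^ d)) := by
    rw [Nat.card_zpowers, hg', Nat.card_congr Multiplicative.toAdd, Nat.card_zmod]
  let e' := mulEquivOfCyclicCardEq hcard
  let χ : G →* Eˣ := (Subgroup.zpowers (g ^ d)).subtype.comp (e.trans e').toMonoidHom
  have hχ : Function.Injective χ := Subtype.val_injective.comp (e.trans e').injective
  have hinj : Function.Injective ((powMonoidHom d).comp χ) := by
    rw [injective_iff_map_eq_one]
    intro x hx
    apply hχ
    rw [map_one, ← orderOf_eq_one_iff]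
    have h1 : orderOf (χ x) ∣ d := orderOf_dvd_of_pow_eq_one hx
    have h2 : orderOf (χ x) ∣ 2 ^ m := by
      rw [← hg', ← Nat.card_zpowers (g ^ d)]
      change orderOf (e' (e x) : Eˣ) ∣ _
      rw [Subgroup.orderOf_coe]
      exact orderOf_dvd_natCard _
    exact Nat.eq_one_of_dvd_coprimes (hd.coprime_two_right.pow_right m) h1 h2
  refine ⟨(Units.coeHom E).comp χ, fun x y hxy => hinj (Units.ext ?_)⟩
  simpa using hxy

end Characters

/-! ### Genericity -/

theorem mainTheorem7 (p : ℕ) [Fact p.Prime] (hp : p ≠ 2) (m n d : ℕ)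
    (hm : 2 ^ m ∣ p ^ n - 1) (hm' : ¬ 2 ^ (m + 1) ∣ p ^ n - 1) (hd : d = (p ^ n - 1) / 2 ^ m)
    (b : Module.Basis (Fin n) (ZMod p) (GaloisField p n)) :
    generalMatrix b ∈ weilRestrictionGm b (FractionRing (MvPolynomial (Fin n) (ZMod p))) ∧
    IsGenericFrobeniusModule.{u, v} (ZMod p) (Multiplicative (ZMod (2 ^ m)))
      (generalMatrix b ^ d) := by
  have hn : n ≠ 0 := by
    rintro rfl
    exact hm' (by simp)
  have hdm : p ^ n - 1 = d * 2 ^ m := by rw [hd, Nat.div_mul_cancel hm]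
  have hdodd : Odd d := by
    rw [← Nat.not_even_iff_odd, even_iff_two_dvd]
    rintro ⟨c, rfl⟩
    exact hm' ⟨c, by rw [hdm, pow_succ]; ring⟩
  have hm0 : m ≠ 0 := by
    rintro rfl
    have h1 : Odd (p ^ n) := ((Fact.out : p.Prime).odd_of_ne_two hp).pow
    obtain ⟨c, hc⟩ := h1
    exact hm' ⟨c, by omega⟩
  have hcard : Nat.card (ZMod p) = p := Nat.card_zmod p
  have hgen := isUnit_det_generalMatrix b
  have hpow : generalMatrix b ^ d = baseMulMatrix _ b (generalElement b ^ d) := by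
    rw [map_pow, generalMatrix_eq_baseMulMatrix]
  have hgal := isGalois_and_nonempty_mulEquiv (Nat.pos_of_ne_zero hn) hm0 hdm b
    (isUnit_generalElement b)
    (sq_mul_frobNorm_generalElement_ne_one b (Nat.pos_of_ne_zero hn))
  rw [← hpow] at hgal
  refine ⟨⟨⟨_, rfl⟩, hgen⟩, ?_⟩
  refine ⟨isFrobeniusModule_of_isUnit_det _ (by rw [Matrix.det_pow]; exact hgen.pow d), ?_, ?_, ?_⟩
  · rw [hcard]
    exact hgal.1
  · rw [hcard]
    exact hgal.2
  · intro L M _ _ _ _ _ _ hG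
    -- `M` carries the `𝔽_p`-algebra structure induced by that of `L`.
    let _ : Algebra (ZMod p) M := ((algebraMap L M).comp (algebraMap (ZMod p) L)).toAlgebra
    have : IsScalarTower (ZMod p) L M := IsScalarTower.of_algebraMap_eq fun _ => rfl
    obtain ⟨χ, hχ⟩ := exists_monoidHom_injective_pow (E := GaloisField p n) hdodd
      (by rw [GaloisField.card p n hn, hdm]) hG
    obtain ⟨ξ, hξ, hiso⟩ := exists_splittingField_mulMatrix_pow b d χ hχ
    refine ⟨ξ, mulMatrix b ξ ^ d, isSpecialization_generalMatrix_pow b d ξ,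
      isFrobeniusModule_of_isUnit_det _ hξ, ?_⟩
    rw [hcard]
    exact hiso
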